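/- Let $\Omega\subset\mathbb R^3$ be a bounded convex domain, and let $\{\mathcal T_h\}$, $0<h<1$, be a shape-regular, quasi-uniform family of conforming finite triangulations into tetrahedra, $\mathcal T_h$ being of size $h$, with computational domains $\Omega_h=\bigcup_{\tau\in\mathcal T_h}\tau\subset\overline\Omega$. That is, there are constants $\gamma,c_1,c_2>0$, independent of $h$, such that every element $\tau\in\mathcal T_h$ satisfies $c_1h\le\operatorname{diam}\tau\le c_2h$ and contains a ball of radius $\gamma\operatorname{diam}\tau$. Let $V_h^0(\Omega_h)$ be the space of continuous functions on $\Omega_h$ that are affine on each $\tau\in\mathcal T_h$ and vanish on $\partial\Omega_h$, extended by zero outside $\Omega_h$. For $z\in\Omega$ let the discrete Green's function $G_h^z\in V_h^0(\Omega_h)$ be defined by $$(\nabla G_h^z,\nabla v_h)_{L^2(\Omega)}=v_h(z)\qquad\text{for all } v_h\in V_h^0(\Omega_h).$$ Then there is a constant $C>0$, independent of $h$ and of $z$, such that $$\|G_h^z\|_{W^1_\infty(\Omega)}\le C\,h^{-2}\qquad\text{for all } h \text{ and all } z\in\Omega,$$ where $\|u\|_{W^1_\infty(\Omega)}=\max\{\|u\|_{L^\infty(\Omega)},\|\nabla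 u\|_{L^\infty(\Omega)}\}$ and $\nabla u$ is the weak gradient. -/

import Mathlib

open MeasureTheory
open scoped ContDiff ENNReal

noncomputable section

namespace FEM

/-- Three-dimensional Euclidean space. -/
abbrev E3 : Type := EuclideanSpace ℝ (Fin 3)

/-! ### The Sobolev norm of `W^{1,∞}` -/

/-- `g` is a weak gradient of `u` on the open set `Ω`:
`∫_Ω u ∂_e φ = - ∫_Ω (g · e) φ` for all `φ ∈ C_c^∞(Ω)` and all directions `e`. -/
def HasWeakGradient (Ω : Set E3) (u : E3 → ℝ) (g : E3 → E3) : Prop :=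
  LocallyIntegrableOn u Ω ∧ LocallyIntegrableOn g Ω ∧
    ∀ φ : E3 → ℝ, ContDiff ℝ ∞ φ → HasCompactSupport φ → tsupport φ ⊆ Ω →
      ∀ e : E3, ∫ x in Ω, u x * fderiv ℝ φ x e = - ∫ x in Ω, inner ℝ (g x) e * φ x

/-- The norm `‖u‖_{W^1_∞(Ω)} = max (‖u‖_{L^∞(Ω)}, ‖∇u‖_{L^∞(Ω)})`, with `∇u` the weak gradient and
`|∇u|` its Euclidean length. Weak gradients are unique almost everywhere on `Ω`, so the infimum
only runs over representatives; it is `∞` if `u` has no weak gradient, so that the norm is finite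
exactly for the elements of `W^1_∞(Ω)`. -/
def sobolevNormW1Inf (Ω : Set E3) (u : E3 → ℝ) : ℝ≥0∞ :=
  ⨅ (g : E3 → E3) (_ : HasWeakGradient Ω u g),
    max (eLpNorm u ∞ (volume.restrict Ω)) (eLpNorm g ∞ (volume.restrict Ω))

/-! ### Triangulations -/

/-- A (conforming, finite) triangulation: a finite simplicial complex in `ℝ³` in which every simplex
is a face of a nondegenerate tetrahedron of the complex. -/
structure Triangulation where
  complex : Geometry.SimplicialComplex ℝ E3
  finite_faces : complex.faces.Finite
  pure : ∀ s ∈ complex.faces, ∃ t ∈ complex.faces, s ⊆ t ∧ t.card = 4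

namespace Triangulation

/-- The vertex sets of the tetrahedra (elements) of the triangulation. -/
def tets (T : Triangulation) : Set (Finset E3) := {s | s ∈ T.complex.faces ∧ s.card = 4}

/-- The computational domain `Ω_h`, the union of the closed elements. -/
def domain (T : Triangulation) : Set E3 := T.complex.space

end Triangulation

/-- The closed element with vertex set `s`. -/
def elem (s : Finset E3) : Set E3 := convexHull ℝ (s : Set E3)

/-- Shape regularity of a family: each element contains a ball whose radius is comparable to the
diameter of the element, uniformly in the family. -/
def IsShapeRegular {ι : Type*} (T : ι → Triangulation) : Prop :=
  ∃ γ : ℝ, 0 < γ ∧ ∀ i, ∀ s ∈ (T i).tets,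
    ∃ x : E3, Metric.closedBall x (γ * Metric.diam (elem s)) ⊆ elem s

/-- Quasi-uniformity of a family of triangulations `T i` of size `h i`: all element diameters are
comparable to `h i`, uniformly in the family. -/
def IsQuasiUniform {ι : Type*} (T : ι → Triangulation) (h : ι → ℝ) : Prop :=
  ∃ c C : ℝ, 0 < c ∧ ∀ i, ∀ s ∈ (T i).tets,
    c * h i ≤ Metric.diam (elem s) ∧ Metric.diam (elem s) ≤ C * h i

/-! ### The finite element space and the discrete Green's function -/

/-- `v ∈ V_h(Ω_h)`: `v` is continuous on `Ω_h` and affine on every element. -/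
def IsVh (T : Triangulation) (v : E3 → ℝ) : Prop :=
  ContinuousOn v T.domain ∧
    ∀ s ∈ T.tets, ∃ A : E3 →ᵃ[ℝ] ℝ, Set.EqOn v A (elem s)

/-- `v ∈ V_h^0(Ω_h)`: `v ∈ V_h(Ω_h)` vanishes on `∂Ω_h`; such functions are extended by zero outside
`Ω_h`, as elements of `H^1_0(Ω)`. -/
def IsVhZero (T : Triangulation) (v : E3 → ℝ) : Prop :=
  IsVh T v ∧ (∀ x ∈ frontier T.domain, v x = 0) ∧ ∀ x ∉ T.domain, v x = 0

/-- `G` is the discrete Green's function `G_h^z` with singularity at `z`: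
`G ∈ V_h^0(Ω_h)` and `(∇G, ∇v)_Ω = v(z)` for all `v ∈ V_h^0(Ω_h)`. The gradients of these piecewise
affine functions are the elementwise ones: they exist off the null set of element boundaries. -/
def IsDiscreteGreen (Ω : Set E3) (T : Triangulation) (z : E3) (G : E3 → ℝ) : Prop :=
  IsVhZero T G ∧ ∀ v : E3 → ℝ, IsVhZero T v →
    ∫ x in Ω, inner ℝ (gradient G x) (gradient v x) = v z

end FEM

end

noncomputable section

namespace FEM

/-! Testing the defining equation with G itself gives E = ‖∇G‖² = G(z), so no pointwise theory of
Green's functions is needed. Two inequalities close the argument. The inverse estimate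
(`IsVhZero.norm_sq_mul_volume_le`) bounds each elementwise gradient by a multiple of h^{-3/2} √E,
since an element contains a ball of radius comparable to h. The discrete Sobolev inequality
(`exists_abs_apply_le`) bounds |G(z)| by h · Lip(G) + √(E/h), up to a constant. Together E ≲ √(E/h),
hence √E ≲ h^{-1/2} and Lip(G) ≲ h^{-2}. As G vanishes outside Ω_h and Ω is bounded, the Lipschitz
bound also controls sup |G|. The Sobolev inequality compares w(0) with a weighted mean of w. The
weight is the divergence of a smoothed Newtonian field that lies in L², so integration by parts and
Cauchy-Schwarz bound the mean by the energy; the oscillation about w(0) costs one Lipschitz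
constant. -/

/-! ### The Newtonian field and the discrete Sobolev inequality -/

/-- The regularized Newtonian field `y ↦ y (1 + |y|²)^{-3/2}`, in the direction `e`. -/
def newtonField (e y : E3) : ℝ := inner ℝ y e * (1 + ‖y‖ ^ 2) ^ (-(3 / 2) : ℝ)

/-- The derivative of `newtonField e`. -/
def newtonFieldDeriv (e y : E3) : E3 →L[ℝ] ℝ :=
  (1 + ‖y‖ ^ 2) ^ (-(3 / 2) : ℝ) • innerSL ℝ e -
    (3 * inner ℝ y e * (1 + ‖y‖ ^ 2) ^ (-(5 / 2) : ℝ)) • innerSL ℝ y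

theorem hasFDerivAt_newtonField (e y : E3) :
    HasFDerivAt (newtonField e) (newtonFieldDeriv e y) y := by
  have h0 : HasFDerivAt (fun y : E3 => 1 + ‖y‖ ^ 2) (2 • innerSL ℝ y) y :=
    (hasStrictFDerivAt_norm_sq y).hasFDerivAt.const_add 1
  have hp : (1 + ‖y‖ ^ 2 : ℝ) ≠ 0 := by positivity
  have h1 := h0.rpow_const (p := (-(3 / 2) : ℝ)) (Or.inl hp)
  have h2 : HasFDerivAt (fun y : E3 => inner ℝ y e) (innerSL ℝ e) y := by
    have := (innerSL ℝ e).hasFDerivAt (x := y)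
    refine this.congr_of_eventuallyEq (Filter.Eventually.of_forall fun x => ?_)
    simp [real_inner_comm]
  have h3 := h2.mul h1
  refine h3.congr_fderiv ?_
  ext v
  have : (-(3 / 2) - 1 : ℝ) = -(5 / 2) := by norm_num
  simp only [newtonFieldDeriv, this, add_apply, sub_apply,
    smul_apply, smul_eq_mul, nsmul_eq_mul]
  push_cast
  ring

theorem continuous_newtonFieldDeriv_apply (e v : E3) :
    Continuous fun y => newtonFieldDeriv e y v := by
  have hp : ∀ p : ℝ, Continuous fun y : E3 => (1 + ‖y‖ ^ 2 : ℝ) ^ p := fun p =>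
    Continuous.rpow_const (by fun_prop) fun y => Or.inl (by positivity)
  have h1 := hp (-(3 / 2))
  have h2 := hp (-(5 / 2))
  simp only [newtonFieldDeriv, sub_apply, smul_apply,
    smul_eq_mul, innerSL_apply_apply]
  fun_prop

theorem norm_le_one_add_sq_rpow (y : E3) : ‖y‖ ≤ (1 + ‖y‖ ^ 2) ^ (1 / 2 : ℝ) := by
  rw [← Real.sqrt_eq_rpow]
  exact Real.le_sqrt_of_sq_le (by linarith)

theorem norm_mul_one_add_sq_rpow_le (y : E3) (p : ℝ) :
    ‖y‖ * (1 + ‖y‖ ^ 2) ^ p ≤ (1 + ‖y‖ ^ 2) ^ (p + 1 / 2) := by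
  rw [add_comm p, Real.rpow_add (by positivity)]
  gcongr
  exact norm_le_one_add_sq_rpow y

theorem one_add_sq_rpow_le_one (y : E3) {p : ℝ} (hp : p ≤ 0) : (1 + ‖y‖ ^ 2) ^ p ≤ 1 :=
  Real.rpow_le_one_of_one_le_of_nonpos (by nlinarith [sq_nonneg ‖y‖]) hp

theorem norm_newtonFieldDeriv_le (e y : E3) : ‖newtonFieldDeriv e y‖ ≤ 4 * ‖e‖ := by
  have h1 := one_add_sq_rpow_le_one y (p := -(3 / 2)) (by norm_num)
  have h2 : ‖y‖ * (‖y‖ * (1 + ‖y‖ ^ 2) ^ (-(5 / 2) : ℝ)) ≤ 1 := by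
    calc _ ≤ ‖y‖ * (1 + ‖y‖ ^ 2) ^ (-(5 / 2) + 1 / 2 : ℝ) := by
          gcongr; exact norm_mul_one_add_sq_rpow_le y _
      _ ≤ (1 + ‖y‖ ^ 2) ^ (-(5 / 2) + 1 / 2 + 1 / 2 : ℝ) := norm_mul_one_add_sq_rpow_le y _
      _ ≤ 1 := one_add_sq_rpow_le_one y (by norm_num)
  have hq : 0 ≤ (1 + ‖y‖ ^ 2) ^ (-(5 / 2) : ℝ) := by positivity
  have hr : 0 ≤ (1 + ‖y‖ ^ 2) ^ (-(3 / 2) : ℝ) := by positivity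
  have hi : |inner ℝ y e| ≤ ‖y‖ * ‖e‖ := abs_real_inner_le_norm y e
  refine (norm_sub_le _ _).trans ?_
  rw [norm_smul, norm_smul, innerSL_apply_norm, innerSL_apply_norm, Real.norm_eq_abs,
    Real.norm_eq_abs, abs_mul, abs_mul, abs_of_nonneg hq, abs_of_nonneg hr, abs_of_pos three_pos]
  calc _ ≤ 1 * ‖e‖ + 3 * (‖y‖ * ‖e‖) * (1 + ‖y‖ ^ 2) ^ (-(5 / 2) : ℝ) * ‖y‖ := by gcongr
    _ = 1 * ‖e‖ + 3 * (‖y‖ * (‖y‖ * (1 + ‖y‖ ^ 2) ^ (-(5 / 2) : ℝ))) * ‖e‖ := by ring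
    _ ≤ 1 * ‖e‖ + 3 * 1 * ‖e‖ := by gcongr
    _ = 4 * ‖e‖ := by ring

theorem lipschitzWith_newtonField (e : E3) : LipschitzWith (4 * ‖e‖₊) (newtonField e) := by
  refine lipschitzWith_of_nnnorm_fderiv_le (𝕜 := ℝ)
    (fun y => (hasFDerivAt_newtonField e y).differentiableAt) fun y => ?_
  rw [(hasFDerivAt_newtonField e y).fderiv]
  exact_mod_cast norm_newtonFieldDeriv_le e y

/-- The decay |y|^{-2} makes the field square integrable in dimension three. -/
theorem abs_newtonField_le (e y : E3) (he : ‖e‖ = 1) :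
    |newtonField e y| ≤ (1 + ‖y‖ ^ 2) ^ (-1 : ℝ) := by
  have hi : |inner ℝ y e| ≤ ‖y‖ := by simpa [he] using abs_real_inner_le_norm y e
  have hr : 0 ≤ (1 + ‖y‖ ^ 2) ^ (-(3 / 2) : ℝ) := by positivity
  rw [newtonField, abs_mul, abs_of_nonneg hr]
  calc _ ≤ ‖y‖ * (1 + ‖y‖ ^ 2) ^ (-(3 / 2) : ℝ) := by gcongr
    _ ≤ (1 + ‖y‖ ^ 2) ^ (-(3 / 2) + 1 / 2 : ℝ) := norm_mul_one_add_sq_rpow_le y _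
    _ = _ := by norm_num

/-- The divergence of the regularized Newtonian field. -/
theorem sum_newtonFieldDeriv (y : E3) :
    ∑ i, newtonFieldDeriv (EuclideanSpace.single i 1) y (EuclideanSpace.single i 1) =
      3 * (1 + ‖y‖ ^ 2) ^ (-(5 / 2) : ℝ) := by
  have h : (1 + ‖y‖ ^ 2) ^ (-(3 / 2) : ℝ) = (1 + ‖y‖ ^ 2) * (1 + ‖y‖ ^ 2) ^ (-(5 / 2) : ℝ) := by
    rw [← Real.rpow_one_add' (by positivity) (by norm_num)]
    norm_num
  have hn : ‖y‖ ^ 2 = y 0 ^ 2 + y 1 ^ 2 + y 2 ^ 2 := by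
    simp [EuclideanSpace.norm_sq_eq, Fin.sum_univ_three]
  simp only [newtonFieldDeriv, sub_apply, smul_apply,
    smul_eq_mul, innerSL_apply_apply, Fin.sum_univ_three, EuclideanSpace.inner_single_right,
    PiLp.single_apply, h]
  set r := (1 + ‖y‖ ^ 2) ^ (-(5 / 2) : ℝ)
  simp
  rw [hn]
  ring

theorem integrable_one_add_sq_rpow {p : ℝ} (hp : p < -(3 / 2)) :
    Integrable fun y : E3 => (1 + ‖y‖ ^ 2) ^ p := by
  have := integrable_rpow_neg_one_add_norm_sq (μ := (volume : Measure E3)) (r := -2 * p)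
    (by simp; linarith)
  convert this using 3
  ring

/-- A Lipschitz function with compact support has a square integrable derivative. -/
theorem integrable_norm_fderiv_sq {w : E3 → ℝ} {M : NNReal} (hw : LipschitzWith M w)
    (hc : HasCompactSupport w) : Integrable fun y => ‖fderiv ℝ w y‖ ^ 2 := by
  have hm : Measurable fun y => ‖fderiv ℝ w y‖ ^ 2 := (measurable_fderiv ℝ w).norm.pow_const 2
  have hs : Function.support (fun y => ‖fderiv ℝ w y‖ ^ 2) ⊆ tsupport w := by
    intro y hy
    refine support_fderiv_subset ℝ (f := w) ?_
    intro h0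
    simp [h0] at hy
  rw [← integrableOn_iff_integrable_of_support_subset hs]
  refine Measure.integrableOn_of_bounded (M := (M : ℝ) ^ 2) hc.isCompact.measure_lt_top.ne
    hm.aestronglyMeasurable (Filter.Eventually.of_forall fun y => ?_)
  have := norm_fderiv_le_of_lipschitz ℝ hw (x₀ := y)
  rw [Real.norm_eq_abs, abs_of_nonneg (by positivity)]
  gcongr

/-- The Cauchy-Schwarz inequality for nonnegative real functions. -/
theorem integral_mul_le_sqrt_mul_sqrt {f g : E3 → ℝ} (hf : 0 ≤ f) (hg : 0 ≤ g)
    (hfm : AEStronglyMeasurable f) (hgm : AEStronglyMeasurable g)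
    (hf2 : Integrable fun y => f y ^ 2) (hg2 : Integrable fun y => g y ^ 2) :
    Integrable (fun y => f y * g y) ∧
      ∫ y, f y * g y ≤ √(∫ y, f y ^ 2) * √(∫ y, g y ^ 2) := by
  have h1 := (memLp_two_iff_integrable_sq hfm).2 hf2
  have h2 := (memLp_two_iff_integrable_sq hgm).2 hg2
  refine ⟨h1.integrable_mul h2, ?_⟩
  have := integral_mul_le_Lp_mul_Lq_of_nonneg (μ := (volume : Measure E3)) (p := 2) (q := 2)
    (f := f) (g := g) (by constructor <;> norm_num) (Filter.Eventually.of_forall hf)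
    (Filter.Eventually.of_forall hg) (by simpa using h1) (by simpa using h2)
  simpa [Real.sqrt_eq_rpow] using this

/-- A discrete Sobolev inequality at unit scale: the value of a compactly supported Lipschitz
function is bounded by its Lipschitz constant and its energy. -/
theorem exists_abs_apply_zero_le : ∃ C : ℝ, 0 < C ∧ ∀ (w : E3 → ℝ) (M : NNReal),
    LipschitzWith M w → HasCompactSupport w →
      |w 0| ≤ C * (M + √(∫ y, ‖fderiv ℝ w y‖ ^ 2)) := by
  -- `k` is a third of the divergence of the field. `q` dominates each component of the field, and
  -- `q ^ 2` dominates `‖y‖ * k y`.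
  set k : E3 → ℝ := fun y => (1 + ‖y‖ ^ 2) ^ (-(5 / 2) : ℝ) with hk
  set q : E3 → ℝ := fun y => (1 + ‖y‖ ^ 2) ^ (-1 : ℝ) with hq
  have hpc : ∀ p : ℝ, Continuous fun y : E3 => (1 + ‖y‖ ^ 2 : ℝ) ^ p := fun p =>
    Continuous.rpow_const (by fun_prop) fun y => Or.inl (by positivity)
  have hk_int : Integrable k := integrable_one_add_sq_rpow (by norm_num)
  have hk_pos : ∀ y, 0 < k y := fun y => by simp only [hk]; positivity
  have hq_pos : ∀ y, 0 < q y := fun y => by simp only [hq]; positivity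
  have hq2 : ∀ y, q y ^ 2 = (1 + ‖y‖ ^ 2) ^ (-2 : ℝ) := fun y => by
    rw [hq, ← Real.rpow_mul_natCast (by positivity)]; norm_num
  have hq_int : Integrable fun y => q y ^ 2 := by
    simp only [hq2]; exact integrable_one_add_sq_rpow (by norm_num)
  have hc0 : 0 < ∫ y, k y := by
    rw [integral_pos_iff_support_of_nonneg (fun y => (hk_pos y).le) hk_int,
      Set.eq_univ_of_forall (s := Function.support k) fun y => (hk_pos y).ne']
    simp
  set I := ∫ y, q y ^ 2
  have hI : 0 ≤ I := integral_nonneg fun y => sq_nonneg _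
  refine ⟨(√I + I + 1) / ∫ y, k y, by positivity, fun w M hw hc => ?_⟩
  set K := √(∫ y, ‖fderiv ℝ w y‖ ^ 2)
  have hK : 0 ≤ K := Real.sqrt_nonneg _
  obtain ⟨hfq, hfq'⟩ := integral_mul_le_sqrt_mul_sqrt (f := fun y => ‖fderiv ℝ w y‖) (g := q)
    (fun y => norm_nonneg _) (fun y => (hq_pos y).le)
    (measurable_fderiv ℝ w).norm.aestronglyMeasurable (hpc _).aestronglyMeasurable
    (integrable_norm_fderiv_sq hw hc) hq_int
  have hkw : Integrable fun y => k y * w y :=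
    ((hpc _).mul hw.continuous).integrable_of_hasCompactSupport hc.mul_left
  -- Mean value: integrate by parts in each coordinate, then apply Cauchy-Schwarz.
  have hdiv : |∫ y, k y * w y| ≤ K * √I := by
    have e1 : 3 * ∫ y, k y * w y = ∑ i : Fin 3, ∫ y,
        lineDeriv ℝ (newtonField (EuclideanSpace.single i 1)) y (EuclideanSpace.single i 1) *
          w y := by
      have hl : ∀ (i : Fin 3) (y : E3),
          lineDeriv ℝ (newtonField (EuclideanSpace.single i 1)) y (EuclideanSpace.single i 1) =
          newtonFieldDeriv (EuclideanSpace.single i 1) y (EuclideanSpace.single i 1) :=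
        fun i y => ((hasFDerivAt_newtonField _ y).hasLineDerivAt _).lineDeriv
      simp only [hl]
      rw [← integral_finsetSum, ← integral_const_mul]
      · congr 1 with y
        rw [← Finset.sum_mul, sum_newtonFieldDeriv]
        ring
      · intro i _
        exact ((continuous_newtonFieldDeriv_apply _ _).mul
          hw.continuous).integrable_of_hasCompactSupport hc.mul_left
    have e2 : ∀ i : Fin 3, |∫ y,
        lineDeriv ℝ (newtonField (EuclideanSpace.single i 1)) y (EuclideanSpace.single i 1) *
          w y| ≤ K * √I := by
      intro i
      rw [(lipschitzWith_newtonField _).integral_lineDeriv_mul_eq hw hc]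
      refine le_trans ?_ hfq'
      rw [← Real.norm_eq_abs]
      refine norm_integral_le_of_norm_le hfq ?_
      filter_upwards [hw.ae_differentiableAt (μ := volume)] with y hy
      rw [hy.lineDeriv_eq_fderiv, norm_mul]
      refine mul_le_mul ?_ (abs_newtonField_le _ _ (by simp)) (norm_nonneg _) (norm_nonneg _)
      refine ((fderiv ℝ w y).le_opNorm _).trans ?_
      simp
    have e3 : |3 * ∫ y, k y * w y| ≤ 3 * (K * √I) := by
      rw [e1]
      refine (Finset.abs_sum_le_sum_abs _ _).trans ((Finset.sum_le_sum fun i _ => e2 i).trans ?_)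
      simp
    rw [abs_mul, abs_of_pos three_pos] at e3
    linarith
  have hosc : |∫ y, k y * (w y - w 0)| ≤ M * I := by
    rw [← Real.norm_eq_abs, ← integral_const_mul]
    refine norm_integral_le_of_norm_le (hq_int.const_mul _) (Filter.Eventually.of_forall fun y => ?_)
    have h1 : |w y - w 0| ≤ M * ‖y‖ := by
      simpa [Real.dist_eq] using hw.dist_le_mul y 0
    rw [norm_mul, Real.norm_of_nonneg (hk_pos y).le, Real.norm_eq_abs, hq2]
    calc k y * |w y - w 0| ≤ k y * (M * ‖y‖) := by gcongr
      _ = M * (‖y‖ * k y) := by ring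
      _ ≤ M * (1 + ‖y‖ ^ 2) ^ (-(5 / 2) + 1 / 2 : ℝ) := by
        gcongr; exact norm_mul_one_add_sq_rpow_le y _
      _ = _ := by norm_num
  have hsplit : (∫ y, k y) * w 0 = (∫ y, k y * w y) - ∫ y, k y * (w y - w 0) := by
    simp only [mul_sub]
    rw [integral_sub hkw (hk_int.mul_const _), integral_mul_const]
    ring
  have : (∫ y, k y) * |w 0| ≤ (√I + I + 1) * (M + K) := by
    have habs : (∫ y, k y) * |w 0| = |(∫ y, k y) * w 0| := by rw [abs_mul, abs_of_pos hc0]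
    rw [habs, hsplit]
    refine (abs_sub _ _).trans ?_
    have : 0 ≤ √I := Real.sqrt_nonneg _
    have : (0 : ℝ) ≤ M := M.2
    nlinarith [mul_nonneg hI hK, mul_nonneg ‹0 ≤ √I› ‹(0 : ℝ) ≤ M›]
  rw [div_mul_eq_mul_div, le_div_iff₀ hc0]
  linarith

open Filter Topology

/-! ### Lipschitz functions in W^1_∞ -/

theorem norm_gradient (u : E3 → ℝ) (x : E3) : ‖gradient u x‖ = ‖fderiv ℝ u x‖ := by
  rw [gradient, LinearIsometryEquiv.norm_map]

theorem measurable_gradient (u : E3 → ℝ) : Measurable (gradient u) :=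
  (LinearIsometryEquiv.continuous _).measurable.comp (measurable_fderiv ℝ u)

/-- The pointwise gradient of a Lipschitz function is its weak gradient. -/
theorem hasWeakGradient_gradient (Ω : Set E3) {u : E3 → ℝ} {M : NNReal}
    (hu : LipschitzWith M u) : HasWeakGradient Ω u (gradient u) := by
  refine ⟨hu.continuous.locallyIntegrable.locallyIntegrableOn _, ?_, fun φ hφ hc hs e => ?_⟩
  · refine ((locallyIntegrable_const (M : ℝ)).mono (g := gradient u)
      (measurable_gradient u).aestronglyMeasurable
      (Eventually.of_forall fun x => ?_)).locallyIntegrableOn _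
    rw [norm_gradient, NNReal.norm_eq]
    exact norm_fderiv_le_of_lipschitz ℝ hu
  have hzero : ∀ x ∉ Ω, φ x = 0 ∧ fderiv ℝ φ x = 0 := fun x hx =>
    ⟨image_eq_zero_of_notMem_tsupport fun h => hx (hs h),
      Function.notMem_support.1 fun h => hx (hs (support_fderiv_subset ℝ h))⟩
  rw [setIntegral_eq_integral_of_forall_compl_eq_zero fun x hx => by simp [(hzero x hx).2],
    setIntegral_eq_integral_of_forall_compl_eq_zero fun x hx => by simp [(hzero x hx).1]]
  obtain ⟨D, hD⟩ := hφ.lipschitzWith_of_hasCompactSupport hc (by simp)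
  -- Integration by parts for Lipschitz functions; Rademacher's theorem then identifies line
  -- derivatives with gradients almost everywhere.
  have key := hu.integral_lineDeriv_mul_eq (μ := volume) hD hc e
  have h1 : ∫ x, lineDeriv ℝ u x e * φ x = ∫ x, inner ℝ (gradient u x) e * φ x := by
    refine integral_congr_ae ?_
    filter_upwards [hu.ae_differentiableAt (μ := volume)] with x hx
    rw [hx.lineDeriv_eq_fderiv, inner_gradient_left]
  have h2 : ∫ x, lineDeriv ℝ φ x (-e) * u x = -∫ x, u x * fderiv ℝ φ x e := by
    rw [← integral_neg]
    congr 1 with x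
    rw [(hφ.differentiable (by simp) x).lineDeriv_eq_fderiv, map_neg]
    ring
  rw [← h1, key, h2, neg_neg]

/-- Lipschitz functions bounded on `Ω` belong to `W^1_∞(Ω)`. -/
theorem sobolevNormW1Inf_le {Ω : Set E3} (hΩ : MeasurableSet Ω) {u : E3 → ℝ} {M : NNReal}
    (hu : LipschitzWith M u) {C : ℝ} (hMC : M ≤ C) (hC : ∀ x ∈ Ω, |u x| ≤ C) :
    sobolevNormW1Inf Ω u ≤ ENNReal.ofReal C := by
  refine (iInf₂_le (gradient u) (hasWeakGradient_gradient Ω hu)).trans (max_le ?_ ?_)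
  · rw [eLpNorm_exponent_top]
    refine eLpNormEssSup_le_of_ae_bound ?_
    filter_upwards [ae_restrict_mem hΩ] with x hx using hC x hx
  · rw [eLpNorm_exponent_top]
    refine eLpNormEssSup_le_of_ae_bound (Eventually.of_forall fun x => ?_)
    rw [norm_gradient]
    exact (norm_fderiv_le_of_lipschitz ℝ hu).trans hMC

/-! ### Finite element functions on a triangulation -/

namespace Triangulation

theorem finite_tets (T : Triangulation) : T.tets.Finite :=
  T.finite_faces.subset fun _ hs => hs.1

theorem domain_eq (T : Triangulation) : T.domain = ⋃ s ∈ T.tets, elem s := by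
  refine Set.Subset.antisymm (Set.iUnion₂_subset fun s hs => ?_)
    (Set.iUnion₂_subset fun s hs => T.complex.convexHull_subset_space hs.1)
  obtain ⟨t, ht, hst, hc⟩ := T.pure s hs
  exact (convexHull_mono (by exact_mod_cast hst)).trans
    (Set.subset_biUnion_of_mem (u := elem) (show t ∈ T.tets from ⟨ht, hc⟩))

end Triangulation

theorem isCompact_elem (s : Finset E3) : IsCompact (elem s) :=
  s.finite_toSet.isCompact_convexHull (𝕜 := ℝ)

theorem Triangulation.isCompact_domain (T : Triangulation) : IsCompact T.domain := by
  rw [T.domain_eq]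
  exact T.finite_tets.isCompact_biUnion fun s _ => isCompact_elem s

namespace IsVhZero

variable {T : Triangulation} {v : E3 → ℝ}

theorem continuous (hv : IsVhZero T v) : Continuous v := by
  have hcl : IsClosed T.domain := T.isCompact_domain.isClosed
  refine continuous_iff_continuousAt.2 fun x => ?_
  by_cases hx : x ∈ T.domain
  · by_cases hi : x ∈ interior T.domain
    · exact hv.1.1.continuousAt (mem_interior_iff_mem_nhds.1 hi)
    · have h0 : v x = 0 := hv.2.1 x (by rw [hcl.frontier_eq]; exact ⟨hx, hi⟩)
      rw [← continuousWithinAt_univ, ← Set.union_compl_self T.domain]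
      refine (hv.1.1 x hx).union ?_
      exact (continuousWithinAt_const (b := (0 : ℝ))).congr (fun y hy => hv.2.2 y hy) h0
  · have : v =ᶠ[𝓝 x] fun _ => 0 := by
      filter_upwards [hcl.isOpen_compl.mem_nhds hx] with y hy using hv.2.2 y hy
    exact continuousAt_const.congr this.symm

theorem hasCompactSupport (hv : IsVhZero T v) : HasCompactSupport v :=
  HasCompactSupport.intro T.isCompact_domain hv.2.2

/-- A bound for the elementwise gradients is a Lipschitz constant. -/
theorem lipschitzWith (hv : IsVhZero T v) {M : NNReal}
    (hA : ∀ s ∈ T.tets, ∃ A : E3 →ᵃ[ℝ] ℝ, Set.EqOn v A (elem s) ∧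
      ‖A.linear.toContinuousLinearMap‖ ≤ M) : LipschitzWith M v := by
  -- On the segment from x to y it suffices that, at each time t, slopes below any r > M‖y - x‖
  -- occur arbitrarily close to the right of t. The segment need not be cut at element boundaries.
  have key : ∀ x y, v y ≤ v x + M * ‖y - x‖ := by
    intro x y
    set ℓ : ℝ → E3 := fun t => x + t • (y - x) with hℓ
    have hℓc : Continuous ℓ := by fun_prop
    have hsub : ∀ t z, ℓ z - ℓ t = (z - t) • (y - x) := fun t z => by
      simp only [hℓ, sub_smul]; abel
    have hM : 0 ≤ M * ‖y - x‖ := by positivity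
    have := image_le_of_liminf_slope_right_le_deriv_boundary (f := v ∘ ℓ) (a := 0) (b := 1)
      (hv.continuous.comp hℓc).continuousOn (B := fun t => v x + M * ‖y - x‖ * t)
      (B' := fun _ => M * ‖y - x‖) (by simp [hℓ]) (by fun_prop)
      (fun t _ => by
        simpa using (((hasDerivAt_id t).const_mul (M * ‖y - x‖)).const_add
          (v x)).hasDerivWithinAt)
      ?_ (Set.right_mem_Icc.2 zero_le_one)
    · simpa [hℓ] using this
    intro t _ r hr
    by_contra hcon
    rw [not_frequently] at hcon
    have hlim : Tendsto ℓ (𝓝[>] t) (𝓝 (ℓ t)) := hℓc.continuousAt.continuousWithinAt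
    have hslope : ∀ z, t < z → v (ℓ z) - v (ℓ t) ≤ M * ‖y - x‖ * (z - t) →
        slope (v ∘ ℓ) t z < r := fun z hz h => by
      rw [slope_def_field, div_lt_iff₀ (sub_pos.2 hz)]
      exact h.trans_lt (mul_lt_mul_of_pos_right hr (sub_pos.2 hz))
    -- If the path is outside Ω_h at times accumulating at t, then v vanishes there and, by
    -- continuity, at time t, so those slopes are 0.
    have hin : ∀ᶠ z in 𝓝[>] t, ℓ z ∈ T.domain := by
      by_contra hf
      rw [not_eventually] at hf
      have h0 : v (ℓ t) = 0 :=
        (isClosed_eq hv.continuous continuous_const).mem_of_frequently_of_tendsto (hf.mono fun z hz => hv.2.2 _ hz) hlim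
      obtain ⟨z, ⟨hz1, hz2⟩, hz3⟩ :=
        ((hf.and_eventually hcon).and_eventually self_mem_nhdsWithin).exists
      refine hz2 (hslope z hz3 ?_)
      rw [h0, hv.2.2 _ hz1, sub_zero]
      exact mul_nonneg hM (sub_nonneg.2 (le_of_lt hz3))
    -- If times in one element accumulate at t, closedness puts ℓ t in it too, and the slope is that
    -- of a single affine function.
    have hout : ∀ᶠ z in 𝓝[>] t, ∀ s ∈ T.tets, ℓ z ∉ elem s := by
      rw [eventually_all_finite T.finite_tets]
      intro s hs
      by_contra hf
      rw [not_eventually] at hf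
      simp only [not_not] at hf
      have ht : ℓ t ∈ elem s :=
        (isCompact_elem s).isClosed.mem_of_frequently_of_tendsto hf hlim
      obtain ⟨z, ⟨hz1, hz2⟩, hz3⟩ :=
        ((hf.and_eventually hcon).and_eventually self_mem_nhdsWithin).exists
      refine hz2 (hslope z hz3 ?_)
      obtain ⟨A, hvA, hAM⟩ := hA s hs
      rw [hvA hz1, hvA ht, ← vsub_eq_sub, ← A.linearMap_vsub, vsub_eq_sub, hsub, map_smul,
        smul_eq_mul, mul_comm]
      refine mul_le_mul_of_nonneg_right ?_ (sub_nonneg.2 (le_of_lt hz3))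
      exact (le_abs_self _).trans
        (A.linear.toContinuousLinearMap.le_of_opNorm_le hAM (y - x))
    obtain ⟨z, hz1, hz2⟩ := (hin.and hout).exists
    rw [T.domain_eq] at hz1
    obtain ⟨s, hs, hz⟩ := Set.mem_iUnion₂.1 hz1
    exact hz2 s hs hz
  exact LipschitzWith.of_le_add_mul M fun x y => by rw [dist_eq_norm]; exact key y x

theorem exists_lipschitzWith (hv : IsVhZero T v) : ∃ M : NNReal, LipschitzWith M v := by
  choose! A hA using hv.1.2
  obtain ⟨M, hM⟩ := (T.finite_tets.image fun s =>
    ‖(A s).linear.toContinuousLinearMap‖₊).bddAbove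
  exact ⟨M, hv.lipschitzWith fun s hs =>
    ⟨A s, hA s hs, by exact_mod_cast hM (Set.mem_image_of_mem _ hs)⟩⟩

/-- The inverse estimate on one element. -/
theorem norm_sq_mul_volume_le (hv : IsVhZero T v) {s : Finset E3} {A : E3 →ᵃ[ℝ] ℝ}
    (hA : Set.EqOn v A (elem s)) {x : E3} {r : ℝ} (hr : Metric.ball x r ⊆ elem s) :
    ‖A.linear.toContinuousLinearMap‖ ^ 2 * volume.real (Metric.ball x r) ≤
      ∫ y, ‖fderiv ℝ v y‖ ^ 2 := by
  obtain ⟨M, hM⟩ := hv.exists_lipschitzWith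
  have hint := integrable_norm_fderiv_sq hM hv.hasCompactSupport
  refine le_trans (le_of_eq ?_) (setIntegral_le_integral (s := Metric.ball x r) hint
    (Eventually.of_forall fun y => sq_nonneg _))
  have : ∀ y ∈ Metric.ball x r, ‖fderiv ℝ v y‖ ^ 2 = ‖A.linear.toContinuousLinearMap‖ ^ 2 := by
    intro y hy
    have h1 : v =ᶠ[𝓝 y] A := by
      filter_upwards [Metric.isOpen_ball.mem_nhds hy] with z hz using hA (hr hz)
    have h2 : HasFDerivAt A A.linear.toContinuousLinearMap y := by
      have := (A.linear.toContinuousLinearMap.hasFDerivAt (x := y)).add_const (A 0)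
      refine this.congr_of_eventuallyEq (Eventually.of_forall fun z => ?_)
      rw [A.decomp]
      simp
    rw [h1.fderiv_eq, h2.fderiv]
  rw [setIntegral_congr_fun Metric.isOpen_ball.measurableSet this]
  simp [mul_comm]

/-- The frontier of a convex set is null, and v vanishes near every point off the closure. -/
theorem setIntegral_norm_fderiv_sq (hv : IsVhZero T v) {Ω : Set E3} (hΩ : Convex ℝ Ω)
    (hT : T.domain ⊆ closure Ω) :
    ∫ y in Ω, ‖fderiv ℝ v y‖ ^ 2 = ∫ y, ‖fderiv ℝ v y‖ ^ 2 := by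
  rw [← setIntegral_congr_set (closure_ae_eq_of_null_frontier (hΩ.addHaar_frontier volume))]
  refine setIntegral_eq_integral_of_forall_compl_eq_zero fun y hy => ?_
  have : v =ᶠ[𝓝 y] fun _ => 0 := by
    filter_upwards [isClosed_closure.isOpen_compl.mem_nhds hy] with z hz
      using hv.2.2 z fun h => hz (hT h)
  simp [this.fderiv_eq]

end IsVhZero

/-! ### Scaling and the gradient bound -/

/-- The discrete Sobolev inequality at scale `h`. -/
theorem exists_abs_apply_le : ∃ C : ℝ, 0 < C ∧ ∀ (u : E3 → ℝ) (M : NNReal) (z : E3) (h : ℝ),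
    0 < h → LipschitzWith M u → HasCompactSupport u →
      |u z| ≤ C * (h * M + √((∫ y, ‖fderiv ℝ u y‖ ^ 2) / h)) := by
  obtain ⟨C, hC, H⟩ := exists_abs_apply_zero_le
  refine ⟨C, hC, fun u M z h hh hu hc => ?_⟩
  have hL : LipschitzWith (h.toNNReal * M) fun y => u (z + h • y) := by
    refine LipschitzWith.of_dist_le_mul fun x y => (hu.dist_le_mul _ _).trans (le_of_eq ?_)
    rw [dist_add_left, dist_smul₀, Real.norm_of_nonneg hh.le]
    push_cast
    rw [Real.coe_toNNReal h hh.le]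
    ring
  have hS : HasCompactSupport fun y => u (z + h • y) :=
    hc.comp_homeomorph ((Homeomorph.smulOfNeZero h hh.ne').trans (Homeomorph.addLeft z))
  -- The chain rule gives h², the change of variables h⁻³.
  have hE : ∫ y, ‖fderiv ℝ (fun y => u (z + h • y)) y‖ ^ 2 = (∫ y, ‖fderiv ℝ u y‖ ^ 2) / h := by
    have h1 : ∀ y, ‖fderiv ℝ (fun y => u (z + h • y)) y‖ ^ 2 =
        h ^ 2 * ‖fderiv ℝ u (z + h • y)‖ ^ 2 := fun y => by
      rw [fderiv_comp_smul (f := fun y => u (z + y)), fderiv_comp_add_left, norm_smul, mul_pow,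
        Real.norm_of_nonneg hh.le]
    simp only [h1]
    rw [integral_const_mul, Measure.integral_comp_smul volume
      (fun y => ‖fderiv ℝ u (z + y)‖ ^ 2), integral_add_left_eq_self (fun y => ‖fderiv ℝ u y‖ ^ 2)]
    rw [finrank_euclideanSpace_fin, abs_of_pos (by positivity), smul_eq_mul]
    field_simp
  have := H _ _ hL hS
  rw [hE] at this
  simpa [hh.le] using this

/-- The gradient bound for the discrete Green's function. -/
theorem exists_lipschitzWith_discreteGreen {ι : Type*} {Ω : Set E3} (hΩ : Convex ℝ Ω)
    {T : ι → Triangulation} {h : ι → ℝ} (hh : ∀ i, 0 < h i)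
    (hT_sub : ∀ i, (T i).domain ⊆ closure Ω)
    (hT_shape : IsShapeRegular T) (hT_unif : IsQuasiUniform T h) :
    ∃ C : NNReal, ∀ i z G, IsDiscreteGreen Ω (T i) z G →
      LipschitzWith (C * (h i ^ 2)⁻¹.toNNReal) G := by
  obtain ⟨γ, hγ, hball⟩ := hT_shape
  obtain ⟨c, _, hc, hdiam⟩ := hT_unif
  obtain ⟨C, hC, hSob⟩ := exists_abs_apply_le
  set κ := volume.real (Metric.ball (0 : E3) 1) with hκ
  have hκ0 : 0 < κ := ENNReal.toReal_pos (Metric.measure_ball_pos _ _ one_pos).ne'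
    measure_ball_lt_top.ne
  -- An inscribed ball of radius γch has volume κ(γch)³, so the inverse estimate reads Lip(G) ≤ bX/h
  -- with X = √(E/h).
  set b := √((κ * (γ * c) ^ 3)⁻¹) with hb
  have hb0 : 0 ≤ b := Real.sqrt_nonneg _
  have hb2 : b ^ 2 = (κ * (γ * c) ^ 3)⁻¹ := Real.sq_sqrt (by positivity)
  refine ⟨(b * (C * (1 + b))).toNNReal, fun i z G hG => ?_⟩
  have hi := hh i
  have hE : ∫ y, ‖fderiv ℝ G y‖ ^ 2 = G z := by
    rw [← hG.2 G hG.1, ← hG.1.setIntegral_norm_fderiv_sq hΩ (hT_sub i)]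
    simp only [real_inner_self_eq_norm_sq, norm_gradient]
  set E := ∫ y, ‖fderiv ℝ G y‖ ^ 2
  have hE0 : 0 ≤ E := integral_nonneg fun y => sq_nonneg _
  set X := √(E / h i) with hX
  have hX0 : 0 ≤ X := Real.sqrt_nonneg _
  have hX2 : X ^ 2 = E / h i := Real.sq_sqrt (by positivity)
  have hlip : LipschitzWith (b * X / h i).toNNReal G := by
    refine hG.1.lipschitzWith fun s hs => ?_
    obtain ⟨A, hA⟩ := hG.1.1.2 s hs
    refine ⟨A, hA, ?_⟩
    rw [Real.coe_toNNReal _ (by positivity)]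
    obtain ⟨x, hx⟩ := hball i s hs
    have hr : γ * (c * h i) ≤ γ * Metric.diam (elem s) := by
      gcongr; exact (hdiam i s hs).1
    have := hG.1.norm_sq_mul_volume_le hA
      (Metric.ball_subset_closedBall.trans ((Metric.closedBall_subset_closedBall hr).trans hx))
    have hvol : volume.real (Metric.ball x (γ * (c * h i))) = (γ * (c * h i)) ^ 3 * κ := by
      rw [Measure.real, Measure.addHaar_ball_of_pos _ _ (by positivity), ENNReal.toReal_mul,
        ENNReal.toReal_ofReal (by positivity), finrank_euclideanSpace_fin]
      rfl
    rw [hvol] at this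
    refine (sq_le_sq₀ (norm_nonneg _) (by positivity)).1 ?_
    rw [div_pow, mul_pow, hb2, hX2]
    rw [← le_div_iff₀ (by positivity)] at this
    refine this.trans (le_of_eq ?_)
    change E / _ = _
    field_simp
  have hle := hSob G _ z (h i) hi hlip hG.1.hasCompactSupport
  rw [Real.coe_toNNReal _ (by positivity), ← hE, abs_of_nonneg hE0, ← hX,
    mul_div_cancel₀ _ hi.ne'] at hle
  -- `hle` is hX² ≤ C(bX + X); cancel one factor X.
  have hXle : X ≤ C * (1 + b) / h i := by
    rw [le_div_iff₀ hi]
    rcases hX0.eq_or_lt with h0 | h0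
    · rw [← h0, zero_mul]; positivity
    · refine le_of_mul_le_mul_left ?_ h0
      have : E = X ^ 2 * h i := by rw [hX2]; field_simp
      nlinarith
  refine hlip.weaken ?_
  rw [← Real.toNNReal_mul (by positivity)]
  refine Real.toNNReal_le_toNNReal ?_
  calc b * X / h i ≤ b * (C * (1 + b) / h i) / h i := by gcongr
    _ = _ := by field_simp

end FEM

end

/-! ### The W^1_∞ estimate -/

theorem mainTheorem9 {Ω : Set FEM.E3} (hΩ_open : IsOpen Ω) (hΩ_convex : Convex ℝ Ω)
    (hΩ_bdd : Bornology.IsBounded Ω)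
    {ι : Type*} (T : ι → FEM.Triangulation) (h : ι → ℝ)
    (hh : ∀ i, 0 < h i ∧ h i < 1)
    (hT_sub : ∀ i, (T i).domain ⊆ closure Ω)
    (hT_shape : FEM.IsShapeRegular T) (hT_unif : FEM.IsQuasiUniform T h) :
    ∃ C : ℝ, 0 < C ∧ ∀ i, ∀ z ∈ Ω, ∀ G : FEM.E3 → ℝ, FEM.IsDiscreteGreen Ω (T i) z G →
      FEM.sobolevNormW1Inf Ω G ≤ ENNReal.ofReal (C * (h i ^ 2)⁻¹) := by
  obtain ⟨C, hC⟩ := FEM.exists_lipschitzWith_discreteGreen hΩ_convex (fun i => (hh i).1) hT_sub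
    hT_shape hT_unif
  obtain ⟨R, hR⟩ := hΩ_bdd.subset_closedBall 0
  set D := 2 * |R| + 1
  have hD : 1 ≤ D := by have := abs_nonneg R; simp only [D]; linarith
  -- A point outside the closed ball around the closure of Ω, hence a zero of every G, at distance
  -- at most D from each point of Ω.
  obtain ⟨y, hy⟩ := exists_norm_eq FEM.E3 (c := |R| + 1) (by positivity)
  refine ⟨C * D + 1, by positivity, fun i z _ G hG => ?_⟩
  have hpos : 0 < (h i ^ 2)⁻¹ := by have := (hh i).1; positivity
  have hlip := hC i z G hG
  have hM : ((C * (h i ^ 2)⁻¹.toNNReal : NNReal) : ℝ) = C * (h i ^ 2)⁻¹ := by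
    rw [NNReal.coe_mul, Real.coe_toNNReal _ hpos.le]
  have hCD : C * (h i ^ 2)⁻¹ * D ≤ (C * D + 1) * (h i ^ 2)⁻¹ := by linarith
  refine FEM.sobolevNormW1Inf_le hΩ_open.measurableSet hlip ?_ fun x hx => ?_
  · rw [hM]
    exact (le_mul_of_one_le_right (by positivity) hD).trans hCD
  · have hGy : G y = 0 := hG.1.2.2 y fun hyT => by
      have := closure_minimal hR Metric.isClosed_closedBall (hT_sub i hyT)
      rw [mem_closedBall_zero_iff, hy] at this
      linarith [le_abs_self R]
    have h1 := hlip.dist_le_mul x y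
    rw [hM, hGy, Real.dist_eq, sub_zero] at h1
    have h2 : dist x y ≤ D := by
      have hx' := mem_closedBall_zero_iff.1 (hR hx)
      rw [dist_eq_norm]
      refine (norm_sub_le x y).trans ?_
      simp only [D]
      linarith [le_abs_self R]
    exact h1.trans ((mul_le_mul_of_nonneg_left h2 (by positivity)).trans hCD)
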